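/- Let $\lambda,q\in\mathbb N$, $s:=16(\lambda+1)$, $r:=s\lambda$, and let $\ell\ge 1$ and $n$ satisfy $r+s+\ell\le n$ (in particular $\ell=\lambda+1$). \textbf{Oracles.} For $n\ge r+\ell$ let $\mathcal O_{n,r,\ell}$ be the following distribution. Sample a uniformly random permutation $\Pi$ of $\{0,1\}^n$; write $H(x)\in\mathbb Z_2^r$ for the first $r$ bits and $J(x)\in\mathbb Z_2^{n-r}$ for the last $n-r$ bits of $\Pi(x)$. Independently for every $\mathbf y\in\mathbb Z_2^r$ sample a uniformly random full column-rank matrix $\mathbf A_{\mathbf y}\in\mathbb Z_2^{n\times(n-r)}$ of the form $\begin{bmatrix}\mathbf I_\ell&\mathbf 0\\ \mathbf K&\mathbf L\end{bmatrix}$ and a uniformly random $\mathbf b_{\mathbf y}\in\mathbb Z_2^n$. The primal oracles are $\mathcal P(x)=(\mathbf y,\mathbf A_{\mathbf y}J(x)+\mathbf b_{\mathbf y})$ with $\mathbf y=H(x)$, and $\mathcal P^{-1}(\mathbf y,\mathbf u)=\Pi^{-1}(\mathbf y,\mathbf z)$ if $\mathbf A_{\mathbf y}\mathbf z+\mathbf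 b_{\mathbf y}=\mathbf u$ for some $\mathbf z$, and $\bot$ otherwise. In the incompressible construction with bloated dual, $\widetilde{\mathcal O}'_{n,r,\ell,s}$, everything is sampled in the same way except that $\mathbf b_{\mathbf y}$ is uniformly random among the vectors whose $\ell$-th coordinate is $1$, and there is in addition the oracle $\mathcal D'(j,\mathbf y,\mathbf v)$, $1\le j\le\ell+1$, that outputs $1$ iff $\mathbf v^T\cdot[\,\mathbf A_{\mathbf y}^{[j:\ell]}\ \ \mathbf A_{\mathbf y}^{[\ell+s+1:n-r]}\,]=0$; here $\mathbf A^{[a:b]}$ denotes columns $a,\dots,b$. \textbf{Algorithms.} Algorithms are quantum query algorithms: arbitrary oracle-independent unitaries interleaved with queries, which may be in superposition (also over which oracle is queried and over not querying), and a final measurement. A \emph{compute/uncompute query} to $f$ exchanges $|x\rangle|\text{blank}\rangle\leftrightarrow|x\rangle|f(x)\rangle$ and fixes the other basis states; a \emph{bit-flip query} maps $|x\rangle|w\rangle\mapsto|x\rangle|w\oplus f(x)\rangle$. \textbf{Claim.} Let $\varepsilon\in\mathbb R$ and suppose that an algorithm $\mathcal A$ making at most $q$ queries satisfies \[\Pr\left[\mathbf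 y_0=\mathbf y_1=:\mathbf y\ \wedge\ \mathbf u_0-\mathbf u_1\notin\mathrm{ColSpan}\left[\,\mathbf A_{\mathbf y}^{[1:\ell]}\ \ \mathbf A_{\mathbf y}^{[\ell+s+1:n-r]}\,\right]\right]\ge\varepsilon,\] where $(\mathcal P,\mathcal P^{-1},\mathcal D')\gets\widetilde{\mathcal O}'_{n,r,\ell,s}$, $(x_0,x_1)\gets\mathcal A^{\mathcal P,\mathcal P^{-1},\mathcal D'}$ and $(\mathbf y_b,\mathbf u_b)=\mathcal P(x_b)$. Then there is an algorithm $\mathcal B$ with \[\Pr\left[\overline{\mathbf y}_0=\overline{\mathbf y}_1\ \wedge\ \overline x_0\ne\overline x_1\right]\ge\varepsilon,\] where $(\overline{\mathcal P},\overline{\mathcal P}^{-1})$ are the primal oracles of $\mathcal O_{r+s,r,0}$, $(\overline x_0,\overline x_1)\gets\mathcal B^{\overline{\mathcal P},\overline{\mathcal P}^{-1}}$ and $(\overline{\mathbf y}_b,\overline{\mathbf u}_b)=\overline{\mathcal P}(\overline x_b)$. If queries (of both $\mathcal A$ and $\mathcal B$) are compute/uncompute queries, $\mathcal B$ makes at most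 $q$ queries; if they are bit-flip queries, $\mathcal B$ makes at most $2q$ queries. -/

import Mathlib

open scoped Matrix

noncomputable section

namespace DualSim

/-! ### Quantum query algorithms -/

/-- A quantum query algorithm. Its Hilbert space has the computational basis `Q × Work`, where `Q`
labels the basis states of the register on which an oracle acts and `Work` is a private finite
workspace of arbitrary size. The algorithm starts in a fixed unit vector, makes `queries` oracle
queries, applies the (oracle independent) unitary `gate i` after query number `i` (counted from
`0`), measures in the computational basis and outputs a function of the outcome. A unitary of a
finite-dimensional space is the same as a norm preserving linear map. -/
structure QueryAlgorithm (Q Out : Type) [Fintype Q] where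
  Work : Type
  fintypeWork : Fintype Work
  queries : ℕ
  init : Q × Work → ℂ
  init_unit : ∑ k, ‖init k‖ ^ 2 = 1
  gate : ℕ → (Q × Work → ℂ) →ₗ[ℂ] (Q × Work → ℂ)
  gate_unitary : ∀ i ψ, ∑ k, ‖gate i ψ k‖ ^ 2 = ∑ k, ‖ψ k‖ ^ 2
  output : Q × Work → Out

attribute [instance] QueryAlgorithm.fintypeWork

variable {Q Out : Type} [Fintype Q]

/-- The state after `i` rounds, when one query maps the basis state `|k⟩` of the query register to
`|U k⟩`, extended linearly. -/
def QueryAlgorithm.state (A : QueryAlgorithm Q Out) (U : Equiv.Perm Q) :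
    ℕ → Q × A.Work → ℂ
  | 0 => A.init
  | i + 1 => A.gate i fun k => A.state U i (U.symm k.1, k.2)

open Classical in
/-- The probability that the output of the algorithm lies in `win`. -/
def QueryAlgorithm.prob (A : QueryAlgorithm Q Out) (U : Equiv.Perm Q) (win : Set Out) : ℝ :=
  ∑ k, if A.output k ∈ win then ‖A.state U A.queries k‖ ^ 2 else 0

open Classical in
/-- A compute/uncompute query to `f : X → Y`. The query register holds a query `some x`, or `none`
for not querying at all, and an answer register which is blank (`none`) or holds an answer. A query
exchanges `|x⟩|blank⟩` and `|x⟩|f x⟩` and fixes all other basis states. -/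
def computeQuery {X Y : Type} (f : X → Y) :
    Equiv.Perm (Option X × Option Y) :=
  Equiv.prodShear (Equiv.refl (Option X)) fun a =>
    match a with
    | none => Equiv.refl (Option Y)
    | some x => Equiv.swap none (some (f x))

/-- A bit-flip query `|x⟩|w⟩ ↦ |x⟩|w + f x⟩`, with `none` for not querying at all. -/
def xorQuery {X W : Type} [AddGroup W] (f : X → W) : Equiv.Perm (Option X × W) :=
  Equiv.prodShear (Equiv.refl (Option X)) fun a =>
    match a with
    | none => Equiv.refl W
    | some x => Equiv.addRight (f x)

/-! ### The oracles -/

/-- Bit strings of length `k`, as vectors over `ℤ₂`. -/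
abbrev Bits (k : ℕ) : Type := Fin k → ZMod 2

/-- Everything that determines the oracles on `n = r + m` bits: the permutation `Π` of `{0,1}^n`,
and for each `y ∈ {0,1}^r` the matrix `A_y ∈ ℤ₂^{n × m}` and the shift `b_y ∈ ℤ₂^n`. -/
abbrev Seed (r m : ℕ) : Type :=
  Equiv.Perm (Bits (r + m)) × (Bits r → Matrix (Fin (r + m)) (Fin m) (ZMod 2)) ×
    (Bits r → Bits (r + m))

variable {r m : ℕ}

def Seed.perm (σ : Seed r m) : Equiv.Perm (Bits (r + m)) := σ.1

def Seed.A (σ : Seed r m) : Bits r → Matrix (Fin (r + m)) (Fin m) (ZMod 2) := σ.2.1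

def Seed.b (σ : Seed r m) : Bits r → Bits (r + m) := σ.2.2

/-- The first `r` bits of `Π x`. -/
def Seed.H (σ : Seed r m) (x : Bits (r + m)) : Bits r := fun i => σ.perm x (Fin.castAdd m i)

/-- The remaining `m = n - r` bits of `Π x`. -/
def Seed.J (σ : Seed r m) (x : Bits (r + m)) : Bits m := fun i => σ.perm x (Fin.natAdd r i)

/-- `𝒫 x = (y, A_y · J x + b_y)` with `y = H x`. -/
def Seed.P (σ : Seed r m) (x : Bits (r + m)) : Bits r × Bits (r + m) :=
  (σ.H x, σ.A (σ.H x) *ᵥ σ.J x + σ.b (σ.H x))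

open Classical in
/-- `𝒫⁻¹ (y, u) = Π⁻¹ (y, z)` if `A_y · z + b_y = u`, and `⊥ = none` if there is no such `z`. -/
def Seed.Pinv (σ : Seed r m) (p : Bits r × Bits (r + m)) : Option (Bits (r + m)) :=
  if h : ∃ z : Bits m, σ.A p.1 *ᵥ z + σ.b p.1 = p.2 then
    some (σ.perm.symm (Fin.append p.1 h.choose))
  else none

open Classical in
/-- The dual oracle bloated by `s`: on `(j, y, v)` it outputs `1` iff `v` is orthogonal to the
columns `j, …, ℓ` and `ℓ + s + 1, …, m` of `A_y` (columns counted from `1`, with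
`j ∈ {1, …, ℓ + 1}`). In the code indices start at `0`. -/
def Seed.bloatedDual (σ : Seed r m) (ℓ s : ℕ) (t : Fin (ℓ + 1) × Bits r × Bits (r + m)) : ZMod 2 :=
  if ∀ k : Fin m, ((t.1 : ℕ) ≤ k ∧ (k : ℕ) < ℓ) ∨ ℓ + s ≤ (k : ℕ) →
      (t.2.2 ᵥ* σ.A t.2.1) k = 0 then 1 else 0

/-- `ColSpan [A_y^{[1:ℓ]}  A_y^{[ℓ+s+1:m]}]`. -/
def Seed.bloatedSpan (σ : Seed r m) (ℓ s : ℕ) (y : Bits r) :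
    Submodule (ZMod 2) (Bits (r + m)) :=
  Submodule.span (ZMod 2) ((σ.A y).col '' {k | (k : ℕ) < ℓ ∨ ℓ + s ≤ (k : ℕ)})

/-! ### The distributions over oracles -/

/-- Matrices of full column rank of the form `[[I_ℓ, 0], [K, L]]`, i.e. whose first `ℓ` rows are
`[I_ℓ  0]`. -/
def IsCosetMatrix (ℓ : ℕ) (A : Matrix (Fin (r + m)) (Fin m) (ZMod 2)) : Prop :=
  (∀ (i : Fin (r + m)) (k : Fin m), (i : ℕ) < ℓ → A i k = if (i : ℕ) = k then 1 else 0) ∧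
    LinearIndependent (ZMod 2) A.col

variable (r m)

open Classical in
/-- `𝒪_{r+m, r, ℓ}` is the uniform distribution on these seeds: `Π` is a uniformly random
permutation and, independently for all `y`, `A_y` is a uniformly random coset matrix and `b_y` is a
uniformly random vector. -/
def plainSeeds (ℓ : ℕ) : Finset (Seed r m) :=
  Finset.univ.filter fun σ => ∀ y, IsCosetMatrix ℓ (σ.A y)

open Classical in
/-- The distribution of the incompressible construction is uniform on these seeds: as
`plainSeeds`, except that `b_y` is uniformly random among the vectors with `ℓ`-th coordinate `1`. -/
def incompressibleSeeds (ℓ : ℕ) : Finset (Seed r m) :=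
  Finset.univ.filter fun σ => (∀ y, IsCosetMatrix ℓ (σ.A y)) ∧
    ∀ y (i : Fin (r + m)), (i : ℕ) + 1 = ℓ → σ.b y i = 1

/-! ### Oracle access -/

abbrev PrimalQuery : Type := Bits (r + m) ⊕ (Bits r × Bits (r + m))

abbrev PrimalAnswer : Type := (Bits r × Bits (r + m)) ⊕ Option (Bits (r + m))

abbrev BloatedQuery (ℓ : ℕ) : Type :=
  Bits (r + m) ⊕ ((Bits r × Bits (r + m)) ⊕ (Fin (ℓ + 1) × Bits r × Bits (r + m)))

abbrev BloatedAnswer : Type := (Bits r × Bits (r + m)) ⊕ (Option (Bits (r + m)) ⊕ ZMod 2)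

/-- Bit-string answer registers for the primal oracles: one for `𝒫` and one for `𝒫⁻¹`, the latter
with a validity flag. -/
abbrev PrimalWord : Type := (Bits r × Bits (r + m)) × (Bits (r + m) × ZMod 2)

/-- The same with a one-bit answer register for the dual oracle. -/
abbrev BloatedWord : Type := (Bits r × Bits (r + m)) × (Bits (r + m) × ZMod 2) × ZMod 2

variable {r m}

/-- The oracles `𝒫, 𝒫⁻¹` as one function on tagged queries. -/
def Seed.primal (σ : Seed r m) : PrimalQuery r m → PrimalAnswer r m := Sum.map σ.P σ.Pinv

/-- The oracles `𝒫, 𝒫⁻¹, 𝒟'` as one function on tagged queries. -/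
def Seed.bloated (σ : Seed r m) (ℓ s : ℕ) : BloatedQuery r m ℓ → BloatedAnswer r m :=
  Sum.map σ.P (Sum.map σ.Pinv (σ.bloatedDual ℓ s))

/-- Bit-string encoding of `{0,1}^k ∪ {⊥}`. -/
def encodeOption {k : ℕ} : Option (Bits k) → Bits k × ZMod 2
  | none => (0, 0)
  | some x => (x, 1)

def encodePrimal : PrimalAnswer r m → PrimalWord r m
  | Sum.inl p => (p, 0)
  | Sum.inr a => (0, encodeOption a)

def encodeBloated : BloatedAnswer r m → BloatedWord r m
  | Sum.inl p => (p, 0, 0)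
  | Sum.inr (Sum.inl a) => (0, encodeOption a, 0)
  | Sum.inr (Sum.inr d) => (0, 0, d)

/-! ### The two games -/

/-- Outputs `(x₀, x₁)` with `y₀ = y₁ =: y` and
`u₀ - u₁ ∉ ColSpan [A_y^{[1:ℓ]}  A_y^{[ℓ+s+1:m]}]`, where `(y_b, u_b) = 𝒫 x_b`. -/
def bloatedWin (ℓ s : ℕ) (σ : Seed r m) : Set (Bits (r + m) × Bits (r + m)) :=
  {x | (σ.P x.1).1 = (σ.P x.2).1 ∧
    (σ.P x.1).2 - (σ.P x.2).2 ∉ σ.bloatedSpan ℓ s (σ.P x.1).1}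

/-- Outputs `(x₀, x₁)` with `y₀ = y₁` and `x₀ ≠ x₁`, where `(y_b, u_b) = 𝒫 x_b`. -/
def collisionWin (σ : Seed r m) : Set (Bits (r + m) × Bits (r + m)) :=
  {x | (σ.P x.1).1 = (σ.P x.2).1 ∧ x.1 ≠ x.2}

abbrev BloatedAlgorithm (r m ℓ : ℕ) : Type 1 :=
  QueryAlgorithm (Option (BloatedQuery r m ℓ) × Option (BloatedAnswer r m))
    (Bits (r + m) × Bits (r + m))

abbrev PrimalAlgorithm (r m : ℕ) : Type 1 :=
  QueryAlgorithm (Option (PrimalQuery r m) × Option (PrimalAnswer r m))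
    (Bits (r + m) × Bits (r + m))

abbrev BloatedXorAlgorithm (r m ℓ : ℕ) : Type 1 :=
  QueryAlgorithm (Option (BloatedQuery r m ℓ) × BloatedWord r m) (Bits (r + m) × Bits (r + m))

abbrev PrimalXorAlgorithm (r m : ℕ) : Type 1 :=
  QueryAlgorithm (Option (PrimalQuery r m) × PrimalWord r m) (Bits (r + m) × Bits (r + m))

/-- Success probability in the bloated-dual collision game, compute/uncompute queries. -/
def BloatedAlgorithm.success {ℓ : ℕ} (A : BloatedAlgorithm r m ℓ) (s : ℕ) : ℝ :=
  (incompressibleSeeds r m ℓ).expect fun σ =>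
    A.prob (computeQuery (σ.bloated ℓ s)) (bloatedWin ℓ s σ)

/-- Success probability in the bloated-dual collision game, bit-flip queries. -/
def BloatedXorAlgorithm.success {ℓ : ℕ} (A : BloatedXorAlgorithm r m ℓ) (s : ℕ) : ℝ :=
  (incompressibleSeeds r m ℓ).expect fun σ =>
    A.prob (xorQuery (encodeBloated ∘ σ.bloated ℓ s)) (bloatedWin ℓ s σ)

/-- Success probability in the collision game for `𝒪_{r+m, r, 0}` with access to `𝒫, 𝒫⁻¹` only,
compute/uncompute queries. -/
def PrimalAlgorithm.success (B : PrimalAlgorithm r m) : ℝ :=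
  (plainSeeds r m 0).expect fun σ => B.prob (computeQuery σ.primal) (collisionWin σ)

/-- Success probability in the collision game for `𝒪_{r+m, r, 0}` with access to `𝒫, 𝒫⁻¹` only,
bit-flip queries. -/
def PrimalXorAlgorithm.success (B : PrimalXorAlgorithm r m) : ℝ :=
  (plainSeeds r m 0).expect fun σ =>
    B.prob (xorQuery (encodePrimal ∘ σ.primal)) (collisionWin σ)

end DualSim

end

/-!
The small instance is embedded in the large one. With `n = r + m` and
`m = ℓ + s + t`, the large permutation acts as the small one on `r + s` of the bits and trivially on
the others, `A_y` is block diagonal with blocks `I_ℓ`, the small matrix `Ā_y` (of size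
`(r + s) × s`) and `I_t`, and `b_y` is `(1, b̄_y, 0)` (`Seed.embed`). Such a seed is then twisted
(`Seed.twist`): `Π` is composed with a permutation `Γ` of the inputs, and each affine map
`z ↦ A_y z + b_y` is followed by `u ↦ C_y u + d_y`, where `C_y` has the form `[[I_ℓ, 0], [K, L]]`.

For a fixed twist the oracles of the large instance are obtained from those of the small one
(`exists_reduction`): `𝒫` and `𝒫⁻¹` are `𝒫̄` and `𝒫̄⁻¹` up to fixed bijections of inputs and outputs,
and the bloated dual only depends on columns of `A_y` that do not involve `Ā_y`. If
`u₀ - u₁` is not spanned by those columns, the two inputs differ in the part that belongs to the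
small instance, so a winning pair yields a collision there.

The twists form a group acting transitively on the seeds of the incompressible construction;
the matrices are handled by extending an isomorphism between column spaces to the whole space
(`exists_linearEquiv_comp_eq`). Hence a uniformly random twist of any embedded seed is uniform, and
averaging gives one fixed twist for which the success probability, averaged over the small instance,
is at least the original one (`exists_le_expect_of_transitive`). The algorithm `ℬ` uses that twist,
so it needs no randomness of its own.

It remains to simulate queries exactly. Every value of the large oracle is either known or an
injective function of one value of the small oracle. For compute/uncompute queries this gives an
injection of basis states that intertwines the two oracles, after splitting off the known values
(`exists_simulation_compute`), and one query suffices. For bit-flip queries the value of the small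
oracle is computed in an ancilla, used, and cleared by a second query
(`exists_simulation_bitFlip`).
-/

noncomputable section

namespace DualSim

/-! ### Transforming query algorithms -/

namespace QueryAlgorithm

/-- A map of query registers acting on basis states, with the workspace unchanged. -/
def lift {Q Q' : Type} (θ : Q → Q') (W : Type) (k : Q × W) : Q' × W := (θ k.1, k.2)

theorem lift_injective {Q Q' : Type} {θ : Q → Q'} (hθ : θ.Injective) (W : Type) :
    (lift θ W).Injective := by
  rintro ⟨a, w⟩ ⟨b, v⟩ h
  obtain ⟨h1, h2⟩ := Prod.ext_iff.1 h
  exact Prod.ext (hθ h1) h2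

/-- Applying a norm preserving change on the coordinates in the range of an injection only
preserves the norm. -/
theorem sum_norm_sq_extend {α β : Type} [Fintype α] [Fintype β] {j : α → β} (hj : j.Injective)
    (φ : α → ℂ) (ψ : β → ℂ) (h : ∑ a, ‖φ a‖ ^ 2 = ∑ a, ‖ψ (j a)‖ ^ 2) :
    ∑ b, ‖Function.extend j φ ψ b‖ ^ 2 = ∑ b, ‖ψ b‖ ^ 2 := by
  classical
  rw [← Finset.sum_add_sum_compl (Finset.univ.image j),
    ← Finset.sum_add_sum_compl (Finset.univ.image j) fun b => ‖ψ b‖ ^ 2]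
  congr 1
  · rw [Finset.sum_image hj.injOn, Finset.sum_image hj.injOn, ← h]
    exact Finset.sum_congr rfl fun a _ => by rw [hj.extend_apply]
  · refine Finset.sum_congr rfl fun b hb => ?_
    rw [Function.extend_apply']
    rintro ⟨a, rfl⟩
    simp at hb

variable {Q Q' Out Out' : Type} [Fintype Q] [Fintype Q']

theorem prob_mono (A : QueryAlgorithm Q Out) (U : Equiv.Perm Q) {s t : Set Out} (h : s ⊆ t) :
    A.prob U s ≤ A.prob U t := by
  classical
  unfold prob
  refine Finset.sum_le_sum fun k _ => ?_
  by_cases hs : A.output k ∈ s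
  · simp [hs, h hs]
  · rw [if_neg hs]
    split_ifs <;> positivity

/-- Post-process the outcome by a function. -/
def mapOutput (A : QueryAlgorithm Q Out) (g : Out → Out') : QueryAlgorithm Q Out' :=
  { A with output := fun k => g (A.output k) }

theorem mapOutput_state (A : QueryAlgorithm Q Out) (g : Out → Out') (U : Equiv.Perm Q) (i : ℕ) :
    (A.mapOutput g).state U i = A.state U i := by
  induction i with
  | zero => rfl
  | succ i ih => simp only [state, ih]; rfl

theorem mapOutput_prob (A : QueryAlgorithm Q Out) (g : Out → Out') (U : Equiv.Perm Q)
    (s : Set Out') : (A.mapOutput g).prob U s = A.prob U (g ⁻¹' s) := by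
  unfold prob
  refine Finset.sum_congr rfl fun k _ => ?_
  erw [mapOutput_state]
  rfl

/-- Relabelling the basis states of the query register by a fixed permutation. -/
def permGate (W : Type) (τ : Equiv.Perm Q) : (Q × W → ℂ) →ₗ[ℂ] (Q × W → ℂ) :=
  LinearMap.funLeft ℂ ℂ fun k : Q × W => (τ.symm k.1, k.2)

theorem permGate_unitary {W : Type} [Fintype W] (τ : Equiv.Perm Q) (ψ : Q × W → ℂ) :
    ∑ k, ‖permGate W τ ψ k‖ ^ 2 = ∑ k, ‖ψ k‖ ^ 2 :=
  Equiv.sum_comp (τ.symm.prodCongr (Equiv.refl W)) fun k => ‖ψ k‖ ^ 2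

/-- The algorithm that applies the fixed permutation `τ` of the query register after each query. -/
def absorb (A : QueryAlgorithm Q Out) (τ : Equiv.Perm Q) : QueryAlgorithm Q Out :=
  { A with
    gate := fun i => A.gate i ∘ₗ permGate A.Work τ
    gate_unitary := fun i ψ => by
      rw [LinearMap.comp_apply, A.gate_unitary, permGate_unitary] }

theorem absorb_state (A : QueryAlgorithm Q Out) (τ U : Equiv.Perm Q) (i : ℕ) :
    (A.absorb τ).state U i = A.state (τ * U) i := by
  induction i with
  | zero => rfl
  | succ i ih => simp only [state, ih]; rfl

theorem absorb_prob (A : QueryAlgorithm Q Out) (τ U : Equiv.Perm Q) (s : Set Out) :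
    (A.absorb τ).prob U s = A.prob (τ * U) s := by
  unfold prob
  refine Finset.sum_congr rfl fun k _ => ?_
  erw [absorb_state]
  rfl

/-- The algorithm that replaces every query by two, with the fixed permutation `τ` of the query
register between them. -/
def double (A : QueryAlgorithm Q Out) (τ : Equiv.Perm Q) : QueryAlgorithm Q Out :=
  { A with
    queries := 2 * A.queries
    gate := fun i => if i % 2 = 0 then permGate A.Work τ else A.gate (i / 2)
    gate_unitary := fun i ψ => by
      split_ifs
      · exact permGate_unitary τ ψ
      · exact A.gate_unitary _ ψ }

theorem double_state (A : QueryAlgorithm Q Out) (τ U : Equiv.Perm Q) (i : ℕ) :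
    (A.double τ).state U (2 * i) = A.state (U * τ * U) i := by
  induction i with
  | zero => rfl
  | succ i ih =>
    -- One step of `A` is two steps: the even gate is `τ`, the odd one the gate of `A`.
    have h0 : (A.double τ).gate (2 * i) = permGate A.Work τ := if_pos (by omega)
    have h1 : (A.double τ).gate (2 * i + 1) = A.gate i := by
      refine (if_neg (by omega)).trans ?_
      congr 1
      omega
    rw [show 2 * (i + 1) = 2 * i + 1 + 1 by ring]
    simp only [state, ih]
    rw [h0, h1]
    rfl

theorem double_prob (A : QueryAlgorithm Q Out) (τ U : Equiv.Perm Q) (s : Set Out) :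
    (A.double τ).prob U s = A.prob (U * τ * U) s := by
  unfold prob
  refine Finset.sum_congr rfl fun k _ => ?_
  erw [double_state]
  rfl

/-- Move a part `K` of the query register, on which the oracle does not act, to the workspace. -/
def moveAncilla {K : Type} [Fintype K] (A : QueryAlgorithm (Q × K) Out) :
    QueryAlgorithm Q Out where
  Work := K × A.Work
  fintypeWork := inferInstance
  queries := A.queries
  init := A.init ∘ (Equiv.prodAssoc Q K A.Work).symm
  init_unit := by
    rw [← A.init_unit]
    exact Equiv.sum_comp (Equiv.prodAssoc Q K A.Work).symm fun k => ‖A.init k‖ ^ 2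
  gate := fun i => LinearMap.funLeft ℂ ℂ (Equiv.prodAssoc Q K A.Work).symm ∘ₗ A.gate i ∘ₗ
    LinearMap.funLeft ℂ ℂ (Equiv.prodAssoc Q K A.Work)
  gate_unitary := fun i ψ => by
    refine (Equiv.sum_comp (Equiv.prodAssoc Q K A.Work).symm fun k =>
      ‖A.gate i (LinearMap.funLeft ℂ ℂ (Equiv.prodAssoc Q K A.Work) ψ) k‖ ^ 2).trans ?_
    rw [A.gate_unitary]
    exact Equiv.sum_comp (Equiv.prodAssoc Q K A.Work) fun k => ‖ψ k‖ ^ 2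
  output := A.output ∘ (Equiv.prodAssoc Q K A.Work).symm

theorem moveAncilla_state {K : Type} [Fintype K] (A : QueryAlgorithm (Q × K) Out)
    (U : Equiv.Perm Q) (i : ℕ) :
    A.moveAncilla.state U i =
      A.state (U.prodCongr (Equiv.refl K)) i ∘ (Equiv.prodAssoc Q K A.Work).symm := by
  induction i with
  | zero => rfl
  | succ i ih => simp only [state, ih]; rfl

theorem moveAncilla_prob {K : Type} [Fintype K] (A : QueryAlgorithm (Q × K) Out)
    (U : Equiv.Perm Q) (s : Set Out) :
    A.moveAncilla.prob U s = A.prob (U.prodCongr (Equiv.refl K)) s := by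
  classical
  unfold prob
  refine Eq.trans ?_ (Equiv.sum_comp (Equiv.prodAssoc Q K A.Work).symm fun k =>
    if A.output k ∈ s then ‖A.state (U.prodCongr (Equiv.refl K)) A.queries k‖ ^ 2 else 0)
  refine Finset.sum_congr rfl fun k _ => ?_
  rw [moveAncilla_state]
  rfl

/-- Run `A` in the coordinate subspace spanned by the image of an injection `θ` of query registers.
The gates are the identity on the orthogonal complement. -/
def transport [Inhabited Out] (A : QueryAlgorithm Q Out) (θ : Q → Q') (hθ : θ.Injective) :
    QueryAlgorithm Q' Out where
  Work := A.Work
  fintypeWork := A.fintypeWork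
  queries := A.queries
  init := Function.extend (lift θ A.Work) A.init 0
  init_unit := by
    rw [← A.init_unit]
    refine (Fintype.sum_of_injective _ (lift_injective hθ A.Work) _ _ (fun k hk => ?_)
      fun k => ?_).symm
    · rw [Function.extend_apply' _ _ _ hk]
      simp
    · rw [(lift_injective hθ _).extend_apply]
  gate := fun i =>
    { toFun := fun ψ => Function.extend (lift θ A.Work) (A.gate i (ψ ∘ lift θ A.Work)) ψ
      map_add' := fun ψ φ => by
        funext k
        by_cases hk : ∃ a, lift θ A.Work a = k
        · obtain ⟨a, rfl⟩ := hk
          simp only [Pi.add_apply, (lift_injective hθ _).extend_apply, Pi.add_comp, map_add]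
        · simp only [Pi.add_apply, Function.extend_apply' _ _ _ hk]
      map_smul' := fun c ψ => by
        funext k
        by_cases hk : ∃ a, lift θ A.Work a = k
        · obtain ⟨a, rfl⟩ := hk
          simp only [Pi.smul_apply, (lift_injective hθ _).extend_apply, Pi.smul_comp, map_smul,
            RingHom.id_apply]
        · simp only [Pi.smul_apply, Function.extend_apply' _ _ _ hk, RingHom.id_apply] }
  gate_unitary := fun i ψ =>
    sum_norm_sq_extend (lift_injective hθ _) _ _ (A.gate_unitary i _)
  output := Function.extend (lift θ A.Work) A.output default

theorem transport_state [Inhabited Out] (A : QueryAlgorithm Q Out) {θ : Q → Q'}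
    (hθ : θ.Injective) {U : Equiv.Perm Q} {U' : Equiv.Perm Q'} (h : ∀ k, U' (θ k) = θ (U k))
    (i : ℕ) :
    (A.transport θ hθ).state U' i = Function.extend (lift θ A.Work) (A.state U i) 0 := by
  have hinj := lift_injective hθ A.Work
  have hs : ∀ k, U'.symm (θ k) = θ (U.symm k) := fun k => by
    rw [Equiv.symm_apply_eq, h, Equiv.apply_symm_apply]
  induction i with
  | zero => rfl
  | succ i ih =>
    have hq : (fun k : Q' × A.Work =>
        Function.extend (lift θ A.Work) (A.state U i) 0 (U'.symm k.1, k.2)) =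
        Function.extend (lift θ A.Work) (fun k => A.state U i (U.symm k.1, k.2)) 0 := by
      funext k
      by_cases hk : ∃ a, lift θ A.Work a = k
      · obtain ⟨a, rfl⟩ := hk
        rw [hinj.extend_apply]
        simp only [lift, hs]
        exact hinj.extend_apply _ _ (U.symm a.1, a.2)
      · rw [Function.extend_apply' _ _ _ hk, Function.extend_apply']
        · rfl
        · rintro ⟨a, ha⟩
          refine hk ⟨(U a.1, a.2), ?_⟩
          obtain ⟨h1, h2⟩ := Prod.ext_iff.1 ha
          exact Prod.ext ((h _).symm.trans (Equiv.eq_symm_apply _ |>.1 h1)) h2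
    simp only [state, ih]
    refine (congrArg ((A.transport θ hθ).gate i) hq).trans ?_
    change Function.extend (lift θ A.Work) (A.gate i (Function.extend (lift θ A.Work)
      (fun k => A.state U i (U.symm k.1, k.2)) 0 ∘ lift θ A.Work)) _ = _
    rw [show ∀ ψ, Function.extend (lift θ A.Work) ψ 0 ∘ lift θ A.Work = ψ from
      fun ψ => funext fun k => hinj.extend_apply ψ 0 k]
    funext k
    by_cases hk : ∃ a, lift θ A.Work a = k
    · obtain ⟨a, rfl⟩ := hk
      rw [hinj.extend_apply, hinj.extend_apply]
    · simp only [Function.extend_apply' _ _ _ hk]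

/-- If the injection intertwines the two oracles, the state stays in the subspace, and the output
distribution is unchanged. -/
theorem transport_prob [Inhabited Out] (A : QueryAlgorithm Q Out) {θ : Q → Q'}
    (hθ : θ.Injective) {U : Equiv.Perm Q} {U' : Equiv.Perm Q'} (h : ∀ k, U' (θ k) = θ (U k))
    (s : Set Out) :
    (A.transport θ hθ).prob U' s = A.prob U s := by
  classical
  have hinj := lift_injective hθ A.Work
  unfold prob
  refine (Fintype.sum_of_injective _ hinj _ _ (fun k hk => ?_) fun k => ?_).symm
  · rw [transport_state A hθ h, Function.extend_apply' _ _ _ hk]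
    simp
  · rw [transport_state A hθ h, hinj.extend_apply]
    change _ = if Function.extend (lift θ A.Work) A.output default (lift θ A.Work k) ∈ s then _
      else _
    rw [hinj.extend_apply]
    rfl

end QueryAlgorithm

/-! ### Simulating one oracle by another -/

section compute

variable {X Y X' Y' : Type} (g : X → Option X') (h : X → Y' → Y)

/-- The basis states of the register of a compute/uncompute query on which a simulated query has to
ask the given oracle: `x` is mapped to a query `x'`, and the answer register is blank or holds
the translation of an answer to `x'`. -/
def IsActive (q : Option X × Option Y) : Prop :=
  ∃ t : X × X' × Option Y', g t.1 = some t.2.1 ∧ q = (some t.1, Option.map (h t.1) t.2.2)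

open Classical in
/-- Translates an active basis state to a basis state for the given oracle, keeping `x` in an
ancilla; all other basis states are kept in the ancilla, with no query. -/
def computeEmbedding (q : Option X × Option Y) :
    (Option X' × Option Y') × (Option X × Option Y) :=
  if hq : IsActive g h q then
    ((some hq.choose.2.1, hq.choose.2.2), (some hq.choose.1, none))
  else ((none, none), q)

variable {g h}

theorem computeEmbedding_of_not_isActive {q : Option X × Option Y} (hq : ¬IsActive g h q) :
    computeEmbedding g h q = ((none, none), q) :=
  dif_neg hq

theorem computeEmbedding_active (hh : ∀ x x', g x = some x' → (h x).Injective) {x : X} {x' : X'}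
    (hx : g x = some x') (b : Option Y') :
    computeEmbedding g h (some x, Option.map (h x) b) = ((some x', b), (some x, none)) := by
  have hq : IsActive g h (some x, Option.map (h x) b) := ⟨(x, x', b), hx, rfl⟩
  have ht : hq.choose = (x, x', b) := by
    obtain ⟨h1, h2⟩ := hq.choose_spec
    generalize hq.choose = t at h1 h2
    obtain ⟨z, z', c⟩ := t
    simp only [Prod.mk.injEq, Option.some.injEq] at h1 h2
    obtain ⟨rfl, h3⟩ := h2
    rw [← Option.some.inj (hx.symm.trans h1), Option.map_injective (hh x x' hx) h3]
  rw [computeEmbedding, dif_pos hq, ht]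

theorem computeEmbedding_injective (hh : ∀ x x', g x = some x' → (h x).Injective) :
    (computeEmbedding g h).Injective := by
  intro p q hpq
  by_cases hp : IsActive g h p <;> by_cases hq : IsActive g h q
  · obtain ⟨⟨x, x', b⟩, hx, rfl⟩ := hp
    obtain ⟨⟨z, z', c⟩, hz, rfl⟩ := hq
    rw [computeEmbedding_active hh hx, computeEmbedding_active hh hz] at hpq
    simp only [Prod.mk.injEq, Option.some.injEq, and_true] at hpq
    obtain ⟨⟨-, rfl⟩, rfl⟩ := hpq
    rfl
  · obtain ⟨⟨x, x', b⟩, hx, rfl⟩ := hp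
    rw [computeEmbedding_active hh hx, computeEmbedding_of_not_isActive hq] at hpq
    simp at hpq
  · obtain ⟨⟨x, x', b⟩, hx, rfl⟩ := hq
    rw [computeEmbedding_active hh hx, computeEmbedding_of_not_isActive hp] at hpq
    simp at hpq
  · rw [computeEmbedding_of_not_isActive hp, computeEmbedding_of_not_isActive hq] at hpq
    exact (Prod.ext_iff.1 hpq).2

open Classical in
/-- The part of a compute/uncompute query to `f` on the `x` with `P x`. -/
def computeQueryOn (P : X → Prop) (f : X → Y) : Equiv.Perm (Option X × Option Y) :=
  Equiv.prodShear (Equiv.refl (Option X)) fun a =>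
    match a with
    | none => Equiv.refl (Option Y)
    | some x => if P x then Equiv.swap none (some (f x)) else Equiv.refl (Option Y)

theorem computeQuery_eq_mul (P : X → Prop) (f c : X → Y) (hc : ∀ x, P x → f x = c x) :
    computeQuery f = computeQueryOn P c * computeQueryOn (fun x => ¬P x) f := by
  ext1 q
  obtain ⟨_ | x, a⟩ := q
  · rfl
  · by_cases hx : P x
    · simp [computeQuery, computeQueryOn, Equiv.prodShear, hx, hc x hx]
    · simp [computeQuery, computeQueryOn, Equiv.prodShear, hx]

theorem computeEmbedding_intertwines (hh : ∀ x x', g x = some x' → (h x).Injective)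
    (f : X → Y) (f' : X' → Y') (hf : ∀ x x', g x = some x' → f x = h x (f' x'))
    (q : Option X × Option Y) :
    ((computeQuery f').prodCongr (Equiv.refl (Option X × Option Y))) (computeEmbedding g h q) =
      computeEmbedding g h (computeQueryOn (fun x => ¬g x = none) f q) := by
  classical
  by_cases hq : IsActive g h q
  · obtain ⟨⟨x, x', b⟩, hx, rfl⟩ := hq
    have : computeQueryOn (fun x => ¬g x = none) f (some x, Option.map (h x) b) =
        (some x, Option.map (h x) (Equiv.swap none (some (f' x')) b)) := by
      rw [(Option.map_injective (hh x x' hx)).map_swap]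
      simp [computeQueryOn, Equiv.prodShear, hx, hf x x' hx]
    rw [this, computeEmbedding_active hh hx, computeEmbedding_active hh hx]
    simp [computeQuery, Equiv.prodShear]
  · have : computeQueryOn (fun x => ¬g x = none) f q = q := by
      obtain ⟨_ | x, a⟩ := q
      · rfl
      · rcases hx : g x with _ | x'
        · simp [computeQueryOn, Equiv.prodShear, hx]
        · simp only [computeQueryOn, Equiv.prodShear, hx, Equiv.coe_fn_mk, Equiv.refl_apply]
          rw [if_pos (by simp), Equiv.swap_apply_of_ne_of_ne]
          · rintro rfl
            exact hq ⟨(x, x', none), hx, rfl⟩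
          · rintro rfl
            exact hq ⟨(x, x', some (f' x')), hx, by rw [hf x x' hx]; rfl⟩
    rw [this, computeEmbedding_of_not_isActive hq]
    simp [computeQuery, Equiv.prodShear]

/-- Compute/uncompute queries to `f` can be simulated, one by one, by compute/uncompute queries to
`f'`, if each value of `f` is either known or an injective function of one value of `f'`. -/
theorem exists_simulation_compute [Fintype X] [Fintype Y] [Fintype X'] [Fintype Y']
    {Out Out' : Type} [Inhabited Out] (A : QueryAlgorithm (Option X × Option Y) Out)
    (hh : ∀ x x', g x = some x' → (h x).Injective) (c : X → Y) (out : Out → Out') :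
    ∃ B : QueryAlgorithm (Option X' × Option Y') Out', B.queries = A.queries ∧
      ∀ (f : X → Y) (f' : X' → Y'), (∀ x, g x = none → f x = c x) →
        (∀ x x', g x = some x' → f x = h x (f' x')) → ∀ win : Set Out',
          B.prob (computeQuery f') win = A.prob (computeQuery f) (out ⁻¹' win) := by
  refine ⟨(((A.absorb (computeQueryOn (fun x => g x = none) c)).transport _
    (computeEmbedding_injective hh)).moveAncilla).mapOutput out, rfl,
    fun f f' hc hf win => ?_⟩
  rw [QueryAlgorithm.mapOutput_prob, QueryAlgorithm.moveAncilla_prob,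
    QueryAlgorithm.transport_prob _ _ (computeEmbedding_intertwines hh f f' hf),
    QueryAlgorithm.absorb_prob, ← computeQuery_eq_mul _ _ _ hc]

end compute

section bitFlip

variable {X W X' W' : Type} [AddGroup W] [AddGroup W']

/-- Adds a function `F` of the query and of the answer of the given oracle to the answer register of
the simulated oracle. -/
def addAnswer (F : X → W' → W) : Equiv.Perm ((Option X' × W') × (Option X × W)) where
  toFun k := (k.1, k.2.1, k.2.2 + k.2.1.elim 0 fun x => F x k.1.2)
  invFun k := (k.1, k.2.1, k.2.2 - k.2.1.elim 0 fun x => F x k.1.2)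
  left_inv k := by simp
  right_inv k := by simp

/-- Bit-flip queries to `f` can each be simulated by two bit-flip queries to `f'`, if each value of
`f` is a function `F` of one value of `f'` (or of nothing): compute the value of `f'` in an
ancilla, add the value of `f` to the answer, and clear the ancilla. -/
theorem exists_simulation_bitFlip [Fintype X] [Fintype W] [Fintype X'] [Fintype W']
    (hW : ∀ w : W', w + w = 0) {Out Out' : Type} [Inhabited Out]
    (A : QueryAlgorithm (Option X × W) Out) (g : X → Option X') (F : X → W' → W)
    (out : Out → Out') :
    ∃ B : QueryAlgorithm (Option X' × W') Out', B.queries = 2 * A.queries ∧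
      ∀ (f : X → W) (f' : X' → W'), (∀ x, g x = none → f x = F x 0) →
        (∀ x x', g x = some x' → f x = F x (f' x')) → ∀ win : Set Out',
          B.prob (xorQuery f') win = A.prob (xorQuery f) (out ⁻¹' win) := by
  let θ : Option X × W → (Option X' × W') × (Option X × W) := fun q => ((q.1.bind g, 0), q)
  have hθ : θ.Injective := fun p q hpq => (Prod.ext_iff.1 hpq).2
  refine ⟨(((A.transport θ hθ).double (addAnswer F)).moveAncilla).mapOutput out, rfl,
    fun f f' hc hf win => ?_⟩
  rw [QueryAlgorithm.mapOutput_prob, QueryAlgorithm.moveAncilla_prob, QueryAlgorithm.double_prob,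
    QueryAlgorithm.transport_prob _ _ (U := xorQuery f)]
  rintro ⟨_ | x, w⟩
  · simp [θ, xorQuery, addAnswer, Equiv.prodShear]
  · rcases hx : g x with _ | x'
    · simp [θ, xorQuery, addAnswer, Equiv.prodShear, hx, hc x hx]
    · simp [θ, xorQuery, addAnswer, Equiv.prodShear, hx, hf x x' hx, hW]

end bitFlip

/-! ### Averaging over a transitive group -/

/-- If a group `G` of permutations preserves `X` and acts transitively on it, then for every `x ∈ X`
the average of `f (g x)` over `g ∈ G` is the average of `f` over `X`. Averaging this over the points
`j y` and exchanging the two averages gives a single `g` that does at least as well. -/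
theorem exists_le_expect_of_transitive {α β : Type} [Finite α] (G : Subgroup (Equiv.Perm α))
    (X : Finset α) (hX : ∀ g ∈ G, ∀ x, x ∈ X ↔ g x ∈ X)
    (htrans : ∀ x ∈ X, ∀ y ∈ X, ∃ g ∈ G, g x = y) (Y : Finset β) (hY : Y.Nonempty)
    (j : β → α) (hj : ∀ y ∈ Y, j y ∈ X) (f : α → ℝ) :
    ∃ g ∈ G, X.expect f ≤ Y.expect fun y => f (g (j y)) := by
  classical
  have := Fintype.ofFinite α
  have hg (g : G) : X.expect f = X.expect fun x => f ((g : Equiv.Perm α) x) :=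
    (Finset.expect_equiv (g : Equiv.Perm α) (fun x => hX g g.2 x) fun _ _ => rfl).symm
  have hconst (x y : α) (hx : x ∈ X) (hy : y ∈ X) :
      (Finset.univ.expect fun g : G => f ((g : Equiv.Perm α) y)) =
        Finset.univ.expect fun g : G => f ((g : Equiv.Perm α) x) := by
    -- Substitute `g * h` for `g` in the average over `G`, where `h x = y`.
    obtain ⟨h, hh, rfl⟩ := htrans x hx y hy
    exact Fintype.expect_equiv (Equiv.mulRight (⟨h, hh⟩ : G)) _ _ fun g => rfl
  have horbit (x : α) (hx : x ∈ X) :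
      X.expect f = Finset.univ.expect fun g : G => f ((g : Equiv.Perm α) x) := by
    calc X.expect f = Finset.univ.expect fun _ : G => X.expect f :=
          (Finset.expect_const Finset.univ_nonempty _).symm
      _ = Finset.univ.expect fun g : G => X.expect fun y => f ((g : Equiv.Perm α) y) :=
          Finset.expect_congr rfl fun g _ => hg g
      _ = X.expect fun y => Finset.univ.expect fun g : G => f ((g : Equiv.Perm α) y) :=
          Finset.expect_comm _ _ _
      _ = X.expect fun _ => Finset.univ.expect fun g : G => f ((g : Equiv.Perm α) x) :=
          Finset.expect_congr rfl fun y hy => hconst x y hx hy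
      _ = _ := Finset.expect_const ⟨x, hx⟩ _
  have havg : X.expect f =
      Finset.univ.expect fun g : G => Y.expect fun y => f ((g : Equiv.Perm α) (j y)) := by
    rw [Finset.expect_comm, Finset.expect_congr rfl fun y hy => (horbit (j y) (hj y hy)).symm,
      Finset.expect_const hY]
  obtain ⟨g, -, hle⟩ := Finset.exists_le_of_le_expect Finset.univ_nonempty havg.le
  exact ⟨g, g.2, hle⟩

/-! ### Extending isomorphisms of subspaces -/

/-- Two injective linear maps into a finite-dimensional space whose compositions with `p` are equal
and surjective differ by an automorphism of the space that preserves `p`. The reason is that both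
ranges have a complement inside the kernel of `p`, and these complements are isomorphic. -/
theorem exists_linearEquiv_comp_eq {K V W F : Type} [Field K] [AddCommGroup V] [Module K V]
    [FiniteDimensional K V] [AddCommGroup W] [Module K W] [AddCommGroup F] [Module K F]
    (a b : W →ₗ[K] V) (ha : Function.Injective a) (hb : Function.Injective b) (p : V →ₗ[K] F)
    (hp : p ∘ₗ a = p ∘ₗ b) (hs : Function.Surjective (p ∘ₗ a)) :
    ∃ e : V ≃ₗ[K] V, (∀ w, e (a w) = b w) ∧ ∀ v, p (e v) = p v := by
  have hcompl (c : W →ₗ[K] V) (hc : Function.Surjective (p ∘ₗ c)) :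
      ∃ C ≤ LinearMap.ker p, IsCompl (LinearMap.range c) C := by
    -- A complement of `range c ⊓ ker p` in `ker p` is one of `range c` in the whole space, as
    -- `range c ⊔ ker p = ⊤`.
    obtain ⟨C, hd, hC⟩ := IsModularLattice.exists_disjoint_and_sup_eq
      (inf_le_right : LinearMap.range c ⊓ LinearMap.ker p ≤ LinearMap.ker p)
    have hle : C ≤ LinearMap.ker p := hC ▸ le_sup_right
    refine ⟨C, hle, ?_, ?_⟩
    · rw [disjoint_iff_inf_le] at hd ⊢
      exact fun x hx => hd ⟨⟨hx.1, hle hx.2⟩, hx.2⟩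
    · rw [codisjoint_iff_le_sup]
      intro v _
      obtain ⟨w, hw⟩ := hc (p v)
      have hk : v - c w ∈ LinearMap.range c ⊓ LinearMap.ker p ⊔ C := by
        rw [hC, LinearMap.mem_ker, map_sub, ← hw, LinearMap.comp_apply, sub_self]
      simpa using add_mem (Submodule.mem_sup_left (T := C) (LinearMap.mem_range_self c w))
        (sup_le_sup_right inf_le_left C hk)
  obtain ⟨C, hCp, hC⟩ := hcompl a hs
  obtain ⟨D, hDp, hD⟩ := hcompl b (hp ▸ hs)
  have hdim : Module.finrank K C = Module.finrank K D := by
    have h1 := Submodule.finrank_add_eq_of_isCompl hC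
    have h2 := Submodule.finrank_add_eq_of_isCompl hD
    rw [LinearMap.finrank_range_of_inj ha] at h1
    rw [LinearMap.finrank_range_of_inj hb] at h2
    omega
  let φ : C ≃ₗ[K] D := LinearEquiv.ofFinrankEq C D hdim
  let ea := LinearEquiv.ofInjective a ha
  let eb := LinearEquiv.ofInjective b hb
  let da := Submodule.prodEquivOfIsCompl _ _ hC
  let db := Submodule.prodEquivOfIsCompl _ _ hD
  let e : V ≃ₗ[K] V := da.symm ≪≫ₗ (ea.symm ≪≫ₗ eb).prodCongr φ ≪≫ₗ db
  have he (w : W) (c : C) : e (a w + c) = b w + φ c := by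
    have : da.symm (a w + c) = (ea w, c) := by
      rw [LinearEquiv.symm_apply_eq]
      rfl
    simp only [e, LinearEquiv.trans_apply, this, LinearEquiv.prodCongr_apply,
      LinearEquiv.symm_apply_apply]
    rfl
  refine ⟨e, fun w => ?_, fun v => ?_⟩
  · simpa using he w 0
  · obtain ⟨⟨⟨_, w, rfl⟩, c⟩, rfl⟩ := da.surjective v
    change p (e (a w + c)) = p (a w + c)
    rw [he, map_add, map_add, LinearMap.mem_ker.1 (hCp c.2), LinearMap.mem_ker.1 (hDp (φ c).2)]
    congr 1
    exact (LinearMap.congr_fun hp w).symm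

/-! ### Rerandomizing the seeds -/

section

variable {r m : ℕ}

/-- Applies an automorphism of the column space to each column. -/
def mapCols (e : Bits (r + m) ≃ₗ[ZMod 2] Bits (r + m)) (M : Matrix (Fin (r + m)) (Fin m) (ZMod 2)) :
    Matrix (Fin (r + m)) (Fin m) (ZMod 2) :=
  Matrix.of fun i k => e (M.col k) i

theorem mapCols_mulVec (e : Bits (r + m) ≃ₗ[ZMod 2] Bits (r + m))
    (M : Matrix (Fin (r + m)) (Fin m) (ZMod 2)) (z : Bits m) :
    mapCols e M *ᵥ z = e (M *ᵥ z) := by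
  have h (N : Matrix (Fin (r + m)) (Fin m) (ZMod 2)) : N *ᵥ z = ∑ k, z k • N.col k := by
    funext i
    simp [Matrix.mulVec, dotProduct, mul_comm]
  rw [h, h, map_sum]
  exact Finset.sum_congr rfl fun k _ => (map_smul e _ _).symm

theorem IsCosetMatrix.mapCols {ℓ : ℕ} {M : Matrix (Fin (r + m)) (Fin m) (ZMod 2)}
    (hM : IsCosetMatrix ℓ M) {e : Bits (r + m) ≃ₗ[ZMod 2] Bits (r + m)}
    (he : ∀ v (i : Fin (r + m)), (i : ℕ) < ℓ → e v i = v i) : IsCosetMatrix ℓ (mapCols e M) :=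
  ⟨fun i k hi => (he _ i hi).trans (hM.1 i k hi), hM.2.map' e.toLinearMap e.ker⟩

/-- The automorphisms `[[I, 0], [K, L]]` act transitively on the coset matrices. -/
theorem IsCosetMatrix.exists_mapCols_eq {ℓ : ℕ} (hℓ : ℓ ≤ m)
    {M N : Matrix (Fin (r + m)) (Fin m) (ZMod 2)} (hM : IsCosetMatrix ℓ M)
    (hN : IsCosetMatrix ℓ N) :
    ∃ e : Bits (r + m) ≃ₗ[ZMod 2] Bits (r + m),
      (∀ v (i : Fin (r + m)), (i : ℕ) < ℓ → e v i = v i) ∧ DualSim.mapCols e M = N := by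
  -- The first `ℓ` coordinates. The form of the matrices says that `p (M z)` is the initial part
  -- of `z`.
  let p : Bits (r + m) →ₗ[ZMod 2] Bits ℓ := LinearMap.funLeft _ _ (Fin.castLE (by omega))
  have hp {M : Matrix (Fin (r + m)) (Fin m) (ZMod 2)} (hM : IsCosetMatrix ℓ M) :
      p ∘ₗ M.mulVecLin = LinearMap.funLeft _ _ (Fin.castLE hℓ) := by
    refine LinearMap.ext fun z => funext fun i => ?_
    change ∑ k, M (Fin.castLE _ i) k * z k = z (Fin.castLE hℓ i)
    rw [Finset.sum_eq_single (Fin.castLE hℓ i)]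
    · rw [hM.1 _ _ (by simp)]
      simp
    · intro k _ hk
      rw [hM.1 _ _ (by simp), if_neg, zero_mul]
      exact fun h => hk (Fin.ext h.symm)
    · simp
  obtain ⟨e, he, hpe⟩ := exists_linearEquiv_comp_eq M.mulVecLin N.mulVecLin
    (Matrix.mulVec_injective_iff.2 hM.2) (Matrix.mulVec_injective_iff.2 hN.2) p
    ((hp hM).trans (hp hN).symm) (by
      rw [hp hM]
      exact LinearMap.funLeft_surjective_of_injective _ _ _ (Fin.castLE_injective hℓ))
  refine ⟨e, fun v i hi => congrFun (hpe v) ⟨i, hi⟩, Matrix.ext_of_mulVec_single fun k => ?_⟩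
  rw [mapCols_mulVec]
  exact he _

/-- The seed with `Π ∘ Γ` in place of `Π`, and with each affine map `z ↦ A_y z + b_y` followed by the
affine automorphism `u ↦ C_y u + d_y`. -/
def Seed.twist (Γ : Equiv.Perm (Bits (r + m)))
    (C : Bits r → (Bits (r + m) ≃ₗ[ZMod 2] Bits (r + m))) (d : Bits r → Bits (r + m))
    (σ : Seed r m) : Seed r m :=
  (σ.perm * Γ, fun y => mapCols (C y) (σ.A y), fun y => C y (σ.b y) + d y)

theorem Seed.twist_P (Γ : Equiv.Perm (Bits (r + m)))
    (C : Bits r → (Bits (r + m) ≃ₗ[ZMod 2] Bits (r + m))) (d : Bits r → Bits (r + m))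
    (σ : Seed r m) (x : Bits (r + m)) :
    (σ.twist Γ C d).P x = ((σ.P (Γ x)).1, C (σ.P (Γ x)).1 (σ.P (Γ x)).2 + d (σ.P (Γ x)).1) := by
  change (σ.H (Γ x), mapCols (C (σ.H (Γ x))) (σ.A (σ.H (Γ x))) *ᵥ σ.J (Γ x) +
    (C (σ.H (Γ x)) (σ.b (σ.H (Γ x))) + d (σ.H (Γ x)))) = _
  rw [mapCols_mulVec, ← add_assoc, ← map_add]
  rfl

theorem Seed.twist_injective (Γ : Equiv.Perm (Bits (r + m)))
    (C : Bits r → (Bits (r + m) ≃ₗ[ZMod 2] Bits (r + m))) (d : Bits r → Bits (r + m)) :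
    Function.Injective (Seed.twist (m := m) Γ C d) := by
  intro σ τ h
  obtain ⟨h1, h⟩ := Prod.ext_iff.1 h
  obtain ⟨h2, h3⟩ := Prod.ext_iff.1 h
  refine Prod.ext (mul_right_cancel h1) (Prod.ext (funext fun y => ?_) (funext fun y => ?_))
  · refine Matrix.ext fun i k => ?_
    refine congrFun ((C y).injective (funext fun i => ?_) : (σ.A y).col k = (τ.A y).col k) i
    exact congrFun (congrFun (congrFun h2 y) i) k
  · exact (C y).injective (add_right_cancel (congrFun h3 y))

/-- The group of twists for which `C_y` fixes the first `ℓ` coordinates of every vector, i.e. has the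
form `[[I_ℓ, 0], [K, L]]`, and the `ℓ`-th coordinate of `d_y` is zero. -/
def twistGroup (r m ℓ : ℕ) : Subgroup (Equiv.Perm (Seed r m)) where
  carrier := {g | ∃ Γ C d, (∀ y v (i : Fin (r + m)), (i : ℕ) < ℓ → C y v i = v i) ∧
    (∀ y (i : Fin (r + m)), (i : ℕ) + 1 = ℓ → d y i = 0) ∧ ∀ σ, g σ = σ.twist Γ C d}
  one_mem' := ⟨1, fun _ => LinearEquiv.refl _ _, 0, fun _ _ _ _ => rfl, fun _ _ _ => rfl,
    fun σ => by
      refine Prod.ext rfl (Prod.ext rfl (funext fun y => ?_))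
      exact (add_zero _).symm⟩
  mul_mem' := by
    rintro g g' ⟨Γ, C, d, hC, hd, hg⟩ ⟨Γ', C', d', hC', hd', hg'⟩
    refine ⟨Γ' * Γ, fun y => C' y ≪≫ₗ C y, fun y => C y (d' y) + d y,
      fun y v i hi => (hC y _ i hi).trans (hC' y v i hi), fun y i hi => ?_, fun σ => ?_⟩
    · change C y (d' y) i + d y i = 0
      rw [hC y _ i (by omega), hd' y i hi, hd y i hi, add_zero]
    · rw [Equiv.Perm.mul_apply, hg', hg]
      refine Prod.ext rfl (Prod.ext rfl (funext fun y => ?_))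
      change C y (C' y (σ.b y) + d' y) + d y = C y (C' y (σ.b y)) + (C y (d' y) + d y)
      rw [map_add, add_assoc]
  inv_mem' := by
    rintro g ⟨Γ, C, d, hC, hd, hg⟩
    have hC' (y v) (i : Fin (r + m)) (hi : (i : ℕ) < ℓ) : (C y).symm v i = v i := by
      rw [← hC y ((C y).symm v) i hi, LinearEquiv.apply_symm_apply]
    refine ⟨Γ⁻¹, fun y => (C y).symm, fun y => -(C y).symm (d y), hC', fun y i hi => ?_,
      fun σ => ?_⟩
    · change -(C y).symm (d y) i = 0
      rw [hC' y _ i (by omega), hd y i hi, neg_zero]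
    · rw [Equiv.Perm.inv_eq_iff_eq, hg]
      refine Prod.ext (inv_mul_cancel_right _ _).symm (Prod.ext (funext fun y => ?_)
        (funext fun y => ?_))
      · refine Matrix.ext fun i k => ?_
        change σ.A y i k = C y ((C y).symm ((σ.A y).col k)) i
        rw [LinearEquiv.apply_symm_apply]
        rfl
      · change σ.b y = C y ((C y).symm (σ.b y) + -(C y).symm (d y)) + d y
        rw [map_add, map_neg, LinearEquiv.apply_symm_apply, LinearEquiv.apply_symm_apply,
          neg_add_cancel_right]

theorem mem_incompressibleSeeds {ℓ : ℕ} {σ : Seed r m} : σ ∈ incompressibleSeeds r m ℓ ↔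
    (∀ y, IsCosetMatrix ℓ (σ.A y)) ∧ ∀ y (i : Fin (r + m)), (i : ℕ) + 1 = ℓ → σ.b y i = 1 := by
  simp [incompressibleSeeds]

theorem mem_incompressibleSeeds_iff_of_mem_twistGroup {ℓ : ℕ} {g : Equiv.Perm (Seed r m)}
    (hg : g ∈ twistGroup r m ℓ) (σ : Seed r m) :
    σ ∈ incompressibleSeeds r m ℓ ↔ g σ ∈ incompressibleSeeds r m ℓ := by
  have key {g : Equiv.Perm (Seed r m)} (hg : g ∈ twistGroup r m ℓ) {σ : Seed r m}
      (h : σ ∈ incompressibleSeeds r m ℓ) : g σ ∈ incompressibleSeeds r m ℓ := by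
    obtain ⟨Γ, C, d, hC, hd, hg⟩ := hg
    rw [mem_incompressibleSeeds] at h
    rw [hg, mem_incompressibleSeeds]
    refine ⟨fun y => (h.1 y).mapCols (hC y), fun y i hi => ?_⟩
    change (C y (σ.b y) + d y) i = 1
    rw [Pi.add_apply, hC y _ i (by omega), hd y i hi, h.2 y i hi, add_zero]
  exact ⟨key hg, fun h => by simpa using key (inv_mem hg) h⟩

/-- The twists act transitively on the seeds of the incompressible construction. -/
theorem exists_mem_twistGroup_apply_eq {ℓ : ℕ} (hℓ : ℓ ≤ m) {σ τ : Seed r m}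
    (hσ : σ ∈ incompressibleSeeds r m ℓ) (hτ : τ ∈ incompressibleSeeds r m ℓ) :
    ∃ g ∈ twistGroup r m ℓ, g σ = τ := by
  rw [mem_incompressibleSeeds] at hσ hτ
  choose C hC hCA using fun y => (hσ.1 y).exists_mapCols_eq hℓ (hτ.1 y)
  refine ⟨Equiv.ofBijective _ (Finite.injective_iff_bijective.1
    (Seed.twist_injective (σ.perm⁻¹ * τ.perm) C fun y => τ.b y - C y (σ.b y))),
    ⟨_, C, _, hC, fun y i hi => ?_, fun _ => rfl⟩, ?_⟩
  · simp only [Pi.sub_apply]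
    rw [hC y _ i (by omega), hσ.2 y i hi, hτ.2 y i hi, sub_self]
  · refine Prod.ext (mul_inv_cancel_left _ _) (Prod.ext (funext hCA) (funext fun y => ?_))
    exact add_sub_cancel _ _

/-! ### The oracles of a seed -/

theorem Seed.perm_eq_append (σ : Seed r m) (x : Bits (r + m)) :
    σ.perm x = Fin.append (σ.H x) (σ.J x) := by
  funext i
  refine Fin.addCases (fun i => ?_) (fun i => ?_) i <;> simp [Seed.H, Seed.J]

theorem Seed.P_perm_symm_append (σ : Seed r m) (y : Bits r) (z : Bits m) :
    σ.P (σ.perm.symm (Fin.append y z)) = (y, σ.A y *ᵥ z + σ.b y) := by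
  have hH : σ.H (σ.perm.symm (Fin.append y z)) = y := by
    funext i
    simp [Seed.H]
  have hJ : σ.J (σ.perm.symm (Fin.append y z)) = z := by
    funext i
    simp [Seed.J]
  rw [Seed.P, hH, hJ]

/-- For matrices of full column rank, `𝒫⁻¹` is the partial inverse of `𝒫`. -/
theorem Seed.Pinv_eq_some_iff {σ : Seed r m} (hσ : ∀ y, LinearIndependent (ZMod 2) (σ.A y).col)
    {p : Bits r × Bits (r + m)} {x : Bits (r + m)} : σ.Pinv p = some x ↔ σ.P x = p := by
  rw [Seed.Pinv]
  split_ifs with h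
  · rw [Option.some.injEq]
    have hz := h.choose_spec
    constructor
    · rintro rfl
      rw [P_perm_symm_append, hz]
    · rintro rfl
      rw [Equiv.symm_apply_eq, perm_eq_append]
      congr 1
      exact Matrix.mulVec_injective_iff.2 (hσ _) (add_right_cancel hz)
  · refine iff_of_false (by simp) ?_
    rintro rfl
    exact h ⟨σ.J x, rfl⟩

theorem Seed.bloatedDual_congr {σ τ : Seed r m} {ℓ s : ℕ}
    (h : ∀ y (k : Fin m), (k : ℕ) < ℓ ∨ ℓ + s ≤ (k : ℕ) → (σ.A y).col k = (τ.A y).col k) :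
    σ.bloatedDual ℓ s = τ.bloatedDual ℓ s := by
  funext t
  unfold Seed.bloatedDual
  congr 1
  refine propext (forall_congr' fun k => imp_congr_right fun hk => ?_)
  have := h t.2.1 k (hk.imp_left And.right)
  change t.2.2 ⬝ᵥ (σ.A t.2.1).col k = 0 ↔ t.2.2 ⬝ᵥ (τ.A t.2.1).col k = 0
  rw [this]

theorem Seed.P_sub_P_mem_bloatedSpan {σ : Seed r m} {ℓ s : ℕ} {x x' : Bits (r + m)}
    (hH : σ.H x = σ.H x')
    (hJ : ∀ k : Fin m, ℓ ≤ (k : ℕ) → (k : ℕ) < ℓ + s → σ.J x k = σ.J x' k) :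
    (σ.P x).2 - (σ.P x').2 ∈ σ.bloatedSpan ℓ s (σ.P x).1 := by
  simp only [Seed.P]
  rw [← hH, add_sub_add_right_eq_sub, ← Matrix.mulVec_sub]
  have h : σ.A (σ.H x) *ᵥ (σ.J x - σ.J x') =
      ∑ k, (σ.J x - σ.J x') k • (σ.A (σ.H x)).col k := by
    funext i
    simp [Matrix.mulVec, dotProduct, mul_comm]
  rw [h]
  refine Submodule.sum_mem _ fun k _ => ?_
  by_cases hk : (k : ℕ) < ℓ ∨ ℓ + s ≤ (k : ℕ)
  · exact Submodule.smul_mem _ _ (Submodule.subset_span ⟨k, hk, rfl⟩)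
  · rw [Pi.sub_apply, hJ k (by omega) (by omega), sub_self, zero_smul]
    exact zero_mem _

/-! ### Embedding a small instance -/

/-- The rows of `A_y`: the `ℓ` rows `[I 0]`, the rows of the small matrix, and the remaining ones. -/
def rowBlocks (r s ℓ t : ℕ) : Fin ℓ ⊕ (Fin (r + s) ⊕ Fin t) ≃ Fin (r + (ℓ + (s + t))) :=
  ((Equiv.refl _).sumCongr finSumFinEquiv).trans
    (finSumFinEquiv.trans (finCongr (by omega)))

/-- The columns of `A_y`: the columns `1, …, ℓ`, the columns `ℓ + 1, …, ℓ + s`, and the rest. -/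
def colBlocks (s ℓ t : ℕ) : Fin ℓ ⊕ (Fin s ⊕ Fin t) ≃ Fin (ℓ + (s + t)) :=
  ((Equiv.refl _).sumCongr finSumFinEquiv).trans finSumFinEquiv

section

variable {s ℓ t : ℕ}

/-- The block diagonal matrix with blocks `I_ℓ`, a given matrix, and `I_t`. -/
def blockMatrix (ℓ t : ℕ) (M : Matrix (Fin (r + s)) (Fin s) (ZMod 2)) :
    Matrix (Fin (r + (ℓ + (s + t)))) (Fin (ℓ + (s + t))) (ZMod 2) :=
  (Matrix.fromBlocks 1 0 0 (Matrix.fromBlocks M 0 0 1)).submatrix (rowBlocks r s ℓ t).symm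
    (colBlocks s ℓ t).symm

theorem blockMatrix_mulVec (M : Matrix (Fin (r + s)) (Fin s) (ZMod 2))
    (z : Fin ℓ ⊕ (Fin s ⊕ Fin t) → ZMod 2) :
    blockMatrix ℓ t M *ᵥ (z ∘ (colBlocks s ℓ t).symm) =
      Sum.elim (z ∘ Sum.inl) (Sum.elim (M *ᵥ (z ∘ Sum.inr ∘ Sum.inl)) (z ∘ Sum.inr ∘ Sum.inr)) ∘
        (rowBlocks r s ℓ t).symm := by
  rw [blockMatrix, Matrix.submatrix_mulVec_equiv, Function.comp_assoc, Equiv.self_comp_symm,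
    Function.comp_id, Matrix.fromBlocks_mulVec, Matrix.fromBlocks_mulVec]
  simp [Function.comp_assoc]

theorem isCosetMatrix_blockMatrix {M : Matrix (Fin (r + s)) (Fin s) (ZMod 2)}
    (hM : LinearIndependent (ZMod 2) M.col) : IsCosetMatrix ℓ (blockMatrix ℓ t M) := by
  constructor
  · intro i k hi
    have h1 : i = rowBlocks r s ℓ t (Sum.inl ⟨i, hi⟩) := Fin.ext (by simp [rowBlocks])
    obtain ⟨k, rfl⟩ := (colBlocks s ℓ t).surjective k
    rw [blockMatrix, Matrix.submatrix_apply, Equiv.symm_apply_apply, h1, Equiv.symm_apply_apply]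
    rcases k with k | k | k
    · simp [rowBlocks, colBlocks, Matrix.one_apply, Fin.ext_iff]
    · simp [rowBlocks, colBlocks]
      omega
    · simp [rowBlocks, colBlocks]
      omega
  · rw [← Matrix.mulVec_injective_iff] at hM ⊢
    intro z w h
    obtain ⟨z, rfl⟩ : ∃ z', z' ∘ (colBlocks s ℓ t).symm = z := ⟨z ∘ colBlocks s ℓ t, by
      rw [Function.comp_assoc, Equiv.self_comp_symm, Function.comp_id]⟩
    obtain ⟨w, rfl⟩ : ∃ w', w' ∘ (colBlocks s ℓ t).symm = w := ⟨w ∘ colBlocks s ℓ t, by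
      rw [Function.comp_assoc, Equiv.self_comp_symm, Function.comp_id]⟩
    rw [blockMatrix_mulVec, blockMatrix_mulVec] at h
    have h := (rowBlocks r s ℓ t).symm.surjective.injective_comp_right h
    have h1 := hM (funext fun i => by simpa using congrFun h (Sum.inr (Sum.inl i)))
    congr 1
    funext i
    rcases i with i | i | i
    · simpa using congrFun h (Sum.inl i)
    · exact congrFun h1 i
    · simpa using congrFun h (Sum.inr (Sum.inr i))

/-- Splits the input of `Π` into an input for the small instance and the coordinates of `J` that
are not in the small instance; the same map is used before and after the small permutation. -/
def splitInput (r s ℓ t : ℕ) : Bits (r + (ℓ + (s + t))) ≃ Bits (r + s) × (Bits ℓ × Bits t) where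
  toFun x := (Fin.append (fun i => x (Fin.castAdd _ i))
    fun i => x (Fin.natAdd r (colBlocks s ℓ t (Sum.inr (Sum.inl i)))),
    fun i => x (Fin.natAdd r (colBlocks s ℓ t (Sum.inl i))),
    fun i => x (Fin.natAdd r (colBlocks s ℓ t (Sum.inr (Sum.inr i)))))
  invFun p := Fin.append (fun i => p.1 (Fin.castAdd s i))
    (Sum.elim p.2.1 (Sum.elim (fun i => p.1 (Fin.natAdd r i)) p.2.2) ∘ (colBlocks s ℓ t).symm)
  left_inv x := by
    funext i
    refine Fin.addCases (fun i => ?_) (fun i => ?_) i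
    · simp
    · obtain ⟨i, rfl⟩ := (colBlocks s ℓ t).surjective i
      rcases i with i | i | i <;> simp
  right_inv p := by
    refine Prod.ext (funext fun i => ?_) (Prod.ext (funext fun i => ?_) (funext fun i => ?_))
    · refine Fin.addCases (fun i => ?_) (fun i => ?_) i <;> simp
    · simp
    · simp

/-- Splits an output of `𝒫` into an output for the small instance and the coordinates of `J` that
are not in the small instance, for block diagonal matrices and shifts `(1, b, 0)`; the shift by the
all-ones block is undone in the coordinates `1, …, ℓ`. -/
def splitOutput (r s ℓ t : ℕ) : Bits r × Bits (r + (ℓ + (s + t))) ≃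
    (Bits r × Bits (r + s)) × (Bits ℓ × Bits t) where
  toFun p := ((p.1, fun i => p.2 (rowBlocks r s ℓ t (Sum.inr (Sum.inl i)))),
    (fun i => p.2 (rowBlocks r s ℓ t (Sum.inl i)) - 1),
    fun i => p.2 (rowBlocks r s ℓ t (Sum.inr (Sum.inr i))))
  invFun p := (p.1.1, Sum.elim (p.2.1 + 1) (Sum.elim p.1.2 p.2.2) ∘ (rowBlocks r s ℓ t).symm)
  left_inv p := by
    refine Prod.ext rfl (funext fun i => ?_)
    obtain ⟨i, rfl⟩ := (rowBlocks r s ℓ t).surjective i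
    rcases i with i | i | i <;> simp
  right_inv p := by
    refine Prod.ext (Prod.ext rfl (funext fun i => ?_)) (Prod.ext (funext fun i => ?_)
      (funext fun i => ?_)) <;> simp

/-- The large instance built from a small one: `Π` acts as the small permutation on a part of the
input, `A_y` is block diagonal, and `b_y` is the small shift, padded with ones in the coordinates
`1, …, ℓ` (of which the `ℓ`-th has to be `1`) and with zeros at the end. -/
def Seed.embed (ℓ t : ℕ) (σ : Seed r s) : Seed r (ℓ + (s + t)) :=
  ((splitInput r s ℓ t).trans
      ((σ.perm.prodCongr (Equiv.refl (Bits ℓ × Bits t))).trans (splitInput r s ℓ t).symm),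
    fun y => blockMatrix ℓ t (σ.A y),
    fun y => Sum.elim 1 (Sum.elim (σ.b y) 0) ∘ (rowBlocks r s ℓ t).symm)

theorem Seed.embed_H (σ : Seed r s) (x : Bits (r + (ℓ + (s + t)))) :
    (σ.embed ℓ t).H x = σ.H (splitInput r s ℓ t x).1 := by
  funext i
  simp only [Seed.H, Seed.embed, Seed.perm, splitInput]
  simp

theorem Seed.embed_J (σ : Seed r s) (x : Bits (r + (ℓ + (s + t)))) :
    (σ.embed ℓ t).J x = Sum.elim (splitInput r s ℓ t x).2.1
      (Sum.elim (σ.J (splitInput r s ℓ t x).1) (splitInput r s ℓ t x).2.2) ∘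
        (colBlocks s ℓ t).symm := by
  funext i
  simp only [Seed.J, Seed.embed, Seed.perm, splitInput]
  simp
  rfl

theorem splitOutput_embed_P (σ : Seed r s) (x : Bits (r + (ℓ + (s + t)))) :
    splitOutput r s ℓ t ((σ.embed ℓ t).P x) =
      (σ.P (splitInput r s ℓ t x).1, (splitInput r s ℓ t x).2) := by
  rw [← Equiv.eq_symm_apply, Seed.P, Seed.embed_H, Seed.embed_J]
  change (_, blockMatrix ℓ t (σ.A _) *ᵥ _ + Sum.elim (1 : Bits ℓ) (Sum.elim (σ.b _) (0 : Bits t)) ∘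
    _) = _
  rw [blockMatrix_mulVec]
  refine Prod.ext rfl (funext fun i => ?_)
  obtain ⟨i, rfl⟩ := (rowBlocks r s ℓ t).surjective i
  rcases i with i | i | i
  · simp [splitOutput]
  · simp [splitOutput, Seed.P]
    rfl
  · simp [splitOutput]

theorem Seed.embed_mem_incompressibleSeeds {σ : Seed r s} (hσ : σ ∈ plainSeeds r s 0) :
    σ.embed ℓ t ∈ incompressibleSeeds r (ℓ + (s + t)) ℓ := by
  classical
  rw [mem_incompressibleSeeds]
  refine ⟨fun y => isCosetMatrix_blockMatrix ((Finset.mem_filter.1 hσ).2 y).2, fun y i hi => ?_⟩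
  have h1 : i = rowBlocks r s ℓ t (Sum.inl ⟨i, by omega⟩) := Fin.ext (by simp [rowBlocks])
  rw [h1]
  simp [Seed.embed, Seed.b]

theorem Seed.embed_A_col (σ τ : Seed r s) (y : Bits r) (k : Fin (ℓ + (s + t)))
    (hk : (k : ℕ) < ℓ ∨ ℓ + s ≤ (k : ℕ)) :
    ((σ.embed ℓ t).A y).col k = ((τ.embed ℓ t).A y).col k := by
  obtain ⟨k, rfl⟩ := (colBlocks s ℓ t).surjective k
  funext i
  change blockMatrix ℓ t (σ.A y) i _ = blockMatrix ℓ t (τ.A y) i _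
  simp only [blockMatrix, Matrix.submatrix_apply, Equiv.symm_apply_apply]
  rcases k with k | k | k
  · rcases (rowBlocks r s ℓ t).symm i with i | i | i <;> rfl
  · simp [colBlocks] at hk
    omega
  · rcases (rowBlocks r s ℓ t).symm i with i | i | i <;> rfl

/-- What makes the simulation possible: after any twist, `𝒫` is `𝒫` of the small instance on a part
of the input, up to fixed bijections `E` and `Φ` of inputs and outputs; `𝒟'` does not depend on
the small instance; and winning pairs are mapped to collisions of the small instance. -/
theorem exists_reduction {g : Equiv.Perm (Seed r (ℓ + (s + t)))}
    (hg : g ∈ twistGroup r (ℓ + (s + t)) ℓ) :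
    ∃ (E : Bits (r + (ℓ + (s + t))) ≃ Bits (r + s) × (Bits ℓ × Bits t))
      (Φ : Bits r × Bits (r + (ℓ + (s + t))) ≃ (Bits r × Bits (r + s)) × (Bits ℓ × Bits t))
      (D : Fin (ℓ + 1) × Bits r × Bits (r + (ℓ + (s + t))) → ZMod 2),
      ∀ σ ∈ plainSeeds r s 0,
        (∀ x, (g (σ.embed ℓ t)).P x = Φ.symm (σ.P (E x).1, (E x).2)) ∧
        (∀ p, (g (σ.embed ℓ t)).Pinv p =
          (σ.Pinv (Φ p).1).map fun x => E.symm (x, (Φ p).2)) ∧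
        (g (σ.embed ℓ t)).bloatedDual ℓ s = D ∧
        ∀ x ∈ bloatedWin ℓ s (g (σ.embed ℓ t)), ((E x.1).1, (E x.2).1) ∈ collisionWin σ := by
  classical
  have hmem := fun σ => mem_incompressibleSeeds_iff_of_mem_twistGroup hg σ
  obtain ⟨Γ, C, d, -, -, hg⟩ := hg
  -- The twist of the outputs, `(y, u) ↦ (y, C_y u + d_y)`.
  let Ψ : Bits r × Bits (r + (ℓ + (s + t))) ≃ Bits r × Bits (r + (ℓ + (s + t))) :=
    Equiv.prodShear (Equiv.refl _) fun y => (C y).toEquiv.trans (Equiv.addRight (d y))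
  let E := Γ.trans (splitInput r s ℓ t)
  let Φ := Ψ.symm.trans (splitOutput r s ℓ t)
  have hP (σ : Seed r s) (x) : (g (σ.embed ℓ t)).P x = Φ.symm (σ.P (E x).1, (E x).2) := by
    rw [hg, Seed.twist_P]
    change Ψ ((σ.embed ℓ t).P (Γ x)) = Ψ ((splitOutput r s ℓ t).symm _)
    congr 1
    rw [Equiv.eq_symm_apply, splitOutput_embed_P]
    rfl
  refine ⟨E, Φ, (g (Seed.embed ℓ t (1, 0, 0))).bloatedDual ℓ s, fun σ hσ =>
    ⟨hP σ, fun p => ?_, ?_, fun x hx => ?_⟩⟩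
  · have h1 : ∀ y, LinearIndependent (ZMod 2) ((g (σ.embed ℓ t)).A y).col := fun y =>
      ((mem_incompressibleSeeds.1 ((hmem _).1 (Seed.embed_mem_incompressibleSeeds hσ))).1 y).2
    have h2 : ∀ y, LinearIndependent (ZMod 2) (σ.A y).col := fun y =>
      ((Finset.mem_filter.1 hσ).2 y).2
    refine Option.ext fun x => ?_
    rw [Seed.Pinv_eq_some_iff h1, hP, Equiv.symm_apply_eq, Option.map_eq_some_iff]
    constructor
    · intro h
      refine ⟨(E x).1, (Seed.Pinv_eq_some_iff h2).2 (Prod.ext_iff.1 h).1, ?_⟩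
      rw [← (Prod.ext_iff.1 h).2, Equiv.symm_apply_apply]
    · rintro ⟨z, hz, rfl⟩
      rw [Equiv.apply_symm_apply, (Seed.Pinv_eq_some_iff h2).1 hz]
  · refine Seed.bloatedDual_congr fun y k hk => ?_
    rw [hg, hg]
    funext i
    change C y _ i = C y _ i
    rw [Seed.embed_A_col _ (1, 0, 0) y k hk]
  · obtain ⟨h1, h2⟩ := hx
    have hH (x) : ((g (σ.embed ℓ t)).P x).1 = (σ.P (E x).1).1 := by
      rw [hP]
      rfl
    refine ⟨(hH _).symm.trans (h1.trans (hH _)), fun h => h2 ?_⟩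
    refine Seed.P_sub_P_mem_bloatedSpan h1 fun k hk hk' => ?_
    have hJ (x) : (g (σ.embed ℓ t)).J x = (σ.embed ℓ t).J (Γ x) := by
      rw [hg]
      rfl
    rw [hJ, hJ, Seed.embed_J, Seed.embed_J]
    obtain ⟨k, rfl⟩ := (colBlocks s ℓ t).surjective k
    rcases k with k | k | k
    · simp [colBlocks] at hk
      omega
    · simp only [Function.comp_apply, Equiv.symm_apply_apply, Sum.elim_inr, Sum.elim_inl]
      exact congrArg (fun z => σ.J z k) h
    · simp [colBlocks] at hk'

theorem plainSeeds_nonempty (r s : ℕ) : (plainSeeds r s 0).Nonempty := by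
  classical
  refine ⟨(1, fun _ => Matrix.of fun i k => if i = Fin.natAdd r k then 1 else 0, fun _ => 0),
    Finset.mem_filter.2 ⟨Finset.mem_univ _, fun y => ⟨fun i k hi => absurd hi (by omega), ?_⟩⟩⟩
  rw [← Matrix.mulVec_injective_iff]
  intro z w h
  funext k
  have := congrFun h (Fin.natAdd r k)
  simpa [Seed.A, Matrix.mulVec, dotProduct] using this

end

end

/-! ### The reduction -/

section

variable {r s ℓ t : ℕ} {R : Type} (E : Bits (r + (ℓ + (s + t))) ≃ Bits (r + s) × R)
  (Φ : Bits r × Bits (r + (ℓ + (s + t))) ≃ (Bits r × Bits (r + s)) × R)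
  (D : Fin (ℓ + 1) × Bits r × Bits (r + (ℓ + (s + t))) → ZMod 2)

/-- The query to the small instance that answers a given query, if one is needed. -/
def smallQuery : BloatedQuery r (ℓ + (s + t)) ℓ → Option (PrimalQuery r s)
  | Sum.inl x => some (Sum.inl (E x).1)
  | Sum.inr (Sum.inl p) => some (Sum.inr (Φ p).1)
  | Sum.inr (Sum.inr _) => none

/-- Translates the answers of the small instance, given the part of the input or output that is
not in the small instance. -/
def liftAnswer (w : R) : PrimalAnswer r s → BloatedAnswer r (ℓ + (s + t)) :=
  Sum.map (fun p => Φ.symm (p, w)) fun a => Sum.inl (a.map fun x => E.symm (x, w))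

theorem liftAnswer_injective (w : R) : (liftAnswer E Φ w).Injective :=
  Sum.map_injective.2 ⟨fun _ _ h => (Prod.ext_iff.1 (Φ.symm.injective h)).1, fun _ _ h =>
    Option.map_injective (fun _ _ h => (Prod.ext_iff.1 (E.symm.injective h)).1) (Sum.inl.inj h)⟩

/-- The answer to a query as a function of the answer of the small instance to `smallQuery`. The
value for a query to the dual oracle is arbitrary. -/
def answer : BloatedQuery r (ℓ + (s + t)) ℓ → PrimalAnswer r s → BloatedAnswer r (ℓ + (s + t))
  | Sum.inl x => liftAnswer E Φ (E x).2
  | Sum.inr (Sum.inl p) => liftAnswer E Φ (Φ p).2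
  | Sum.inr (Sum.inr _) => fun _ => Sum.inr (Sum.inl none)

/-- The answer to a query to the dual oracle. -/
def dualAnswer : BloatedQuery r (ℓ + (s + t)) ℓ → BloatedAnswer r (ℓ + (s + t))
  | Sum.inr (Sum.inr v) => Sum.inr (Sum.inr (D v))
  | _ => Sum.inr (Sum.inl none)

/-- Decodes a bit-string answer to a query to the small instance. The query tells which of the two
oracles has answered. -/
def decodePrimal : PrimalQuery r s → PrimalWord r s → PrimalAnswer r s
  | Sum.inl _, w => Sum.inl w.1
  | Sum.inr _, w => Sum.inr (if w.2.2 = 1 then some w.2.1 else none)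

theorem decodePrimal_encodePrimal (σ : Seed r s) (q : PrimalQuery r s) :
    decodePrimal q (encodePrimal (σ.primal q)) = σ.primal q := by
  rcases q with x | p
  · rfl
  · change Sum.inr (if (encodeOption (σ.Pinv p)).2 = 1 then some (encodeOption (σ.Pinv p)).1
      else none) = Sum.inr (σ.Pinv p)
    cases σ.Pinv p <;> simp [encodeOption]

variable {E Φ D}

theorem bloated_eq_dualAnswer {τ : Seed r (ℓ + (s + t))} (hD : τ.bloatedDual ℓ s = D)
    (q : BloatedQuery r (ℓ + (s + t)) ℓ) (hq : smallQuery E Φ q = none) :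
    τ.bloated ℓ s q = dualAnswer D q := by
  rcases q with x | p | v
  · simp [smallQuery] at hq
  · simp [smallQuery] at hq
  · subst hD
    rfl

theorem bloated_eq_answer {σ : Seed r s} {τ : Seed r (ℓ + (s + t))}
    (hP : ∀ x, τ.P x = Φ.symm (σ.P (E x).1, (E x).2))
    (hPinv : ∀ p, τ.Pinv p = (σ.Pinv (Φ p).1).map fun x => E.symm (x, (Φ p).2))
    (q : BloatedQuery r (ℓ + (s + t)) ℓ) (q' : PrimalQuery r s)
    (hq : smallQuery E Φ q = some q') :
    τ.bloated ℓ s q = answer E Φ q (σ.primal q') := by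
  rcases q with x | p | v
  · obtain rfl := Option.some.inj hq
    exact congrArg Sum.inl (hP x)
  · obtain rfl := Option.some.inj hq
    exact congrArg (Sum.inr ∘ Sum.inl) (hPinv p)
  · simp [smallQuery] at hq

theorem answer_injective (q : BloatedQuery r (ℓ + (s + t)) ℓ) (q' : PrimalQuery r s)
    (hq : smallQuery E Φ q = some q') : (answer E Φ q).Injective := by
  rcases q with x | p | v
  · exact liftAnswer_injective E Φ _
  · exact liftAnswer_injective E Φ _
  · simp [smallQuery] at hq

end

/-- Some fixed twist of the embedded small instances is at least as good as the average over all
large instances. -/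
theorem exists_twist_le_expect (r s ℓ t : ℕ) (f : Seed r (ℓ + (s + t)) → ℝ) :
    ∃ g ∈ twistGroup r (ℓ + (s + t)) ℓ, (incompressibleSeeds r (ℓ + (s + t)) ℓ).expect f ≤
      (plainSeeds r s 0).expect fun σ => f (g (σ.embed ℓ t)) :=
  exists_le_expect_of_transitive _ _
    (fun _ hg σ => mem_incompressibleSeeds_iff_of_mem_twistGroup hg σ)
    (fun _ hσ _ hτ => exists_mem_twistGroup_apply_eq (by omega) hσ hτ)
    _ (plainSeeds_nonempty r s) (Seed.embed ℓ t)
    (fun _ hσ => Seed.embed_mem_incompressibleSeeds hσ) f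

/-- The reduction for compute/uncompute queries: one query to the small instance per query. -/
theorem BloatedAlgorithm.exists_primalAlgorithm {r s ℓ t : ℕ}
    (A : BloatedAlgorithm r (ℓ + (s + t)) ℓ) :
    ∃ B : PrimalAlgorithm r s, B.queries = A.queries ∧ A.success s ≤ B.success := by
  obtain ⟨g, hg, hle⟩ := exists_twist_le_expect r s ℓ t fun σ =>
    A.prob (computeQuery (σ.bloated ℓ s)) (bloatedWin ℓ s σ)
  obtain ⟨E, Φ, D, h⟩ := exists_reduction hg
  obtain ⟨B, hB, hsim⟩ := exists_simulation_compute A (answer_injective (E := E) (Φ := Φ))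
    (dualAnswer D) fun x => ((E x.1).1, (E x.2).1)
  refine ⟨B, hB, hle.trans (Finset.expect_le_expect fun σ hσ => ?_)⟩
  obtain ⟨hP, hPinv, hD, hwin⟩ := h σ hσ
  rw [hsim _ _ (bloated_eq_dualAnswer hD) (bloated_eq_answer hP hPinv)]
  exact A.prob_mono _ hwin

theorem PrimalWord.add_self {r s : ℕ} (w : PrimalWord r s) : w + w = 0 := by
  have h {k : ℕ} (v : Bits k) : v + v = 0 := funext fun i => CharTwo.add_self_eq_zero (v i)
  exact Prod.ext (Prod.ext (h _) (h _)) (Prod.ext (h _) (CharTwo.add_self_eq_zero _))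

/-- The reduction for bit-flip queries: two queries to the small instance per query. -/
theorem BloatedXorAlgorithm.exists_primalXorAlgorithm {r s ℓ t : ℕ}
    (A : BloatedXorAlgorithm r (ℓ + (s + t)) ℓ) :
    ∃ B : PrimalXorAlgorithm r s, B.queries = 2 * A.queries ∧ A.success s ≤ B.success := by
  obtain ⟨g, hg, hle⟩ := exists_twist_le_expect r s ℓ t fun σ =>
    A.prob (xorQuery (encodeBloated ∘ σ.bloated ℓ s)) (bloatedWin ℓ s σ)
  obtain ⟨E, Φ, D, h⟩ := exists_reduction hg
  obtain ⟨B, hB, hsim⟩ := exists_simulation_bitFlip (W' := PrimalWord r s)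
    PrimalWord.add_self A (smallQuery E Φ)
    (fun q w => encodeBloated ((smallQuery E Φ q).elim (dualAnswer D q) fun q' =>
      answer E Φ q (decodePrimal q' w)))
    fun x => ((E x.1).1, (E x.2).1)
  refine ⟨B, hB, hle.trans (Finset.expect_le_expect fun σ hσ => ?_)⟩
  obtain ⟨hP, hPinv, hD, hwin⟩ := h σ hσ
  rw [hsim]
  · exact A.prob_mono _ hwin
  · intro q hq
    rw [Function.comp_apply, bloated_eq_dualAnswer hD q hq, hq, Option.elim_none]
  · intro q q' hq
    rw [Function.comp_apply, bloated_eq_answer hP hPinv q q' hq, hq, Option.elim_some,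
      Function.comp_apply, decodePrimal_encodePrimal]

end DualSim

end

theorem mainTheorem10 (lam s r ℓ m q : ℕ) (hs : s = 16 * (lam + 1)) (hr : r = s * lam)
    (hℓ : 1 ≤ ℓ) (hm : s + ℓ ≤ m) (ε : ℝ) :
    (∀ A : DualSim.BloatedAlgorithm r m ℓ, A.queries ≤ q →
      ε ≤ DualSim.BloatedAlgorithm.success A s →
      ∃ B : DualSim.PrimalAlgorithm r s, B.queries ≤ q ∧
        ε ≤ DualSim.PrimalAlgorithm.success B) ∧
    (∀ A : DualSim.BloatedXorAlgorithm r m ℓ, A.queries ≤ q →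
      ε ≤ DualSim.BloatedXorAlgorithm.success A s →
      ∃ B : DualSim.PrimalXorAlgorithm r s, B.queries ≤ 2 * q ∧
        ε ≤ DualSim.PrimalXorAlgorithm.success B) := by
  obtain ⟨t, rfl⟩ : ∃ t, m = ℓ + (s + t) := ⟨m - (s + ℓ), by omega⟩
  refine ⟨fun A hA hε => ?_, fun A hA hε => ?_⟩
  · obtain ⟨B, hB, hle⟩ := A.exists_primalAlgorithm
    exact ⟨B, hB.trans_le hA, hε.trans hle⟩
  · obtain ⟨B, hB, hle⟩ := A.exists_primalXorAlgorithm
    exact ⟨B, hB.trans_le (Nat.mul_le_mul_left 2 hA), hε.trans hle⟩
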